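/- All graphs are simple; $G$ is nonempty and may be finite or infinite (it is locally finite by the maximum degree condition). The average degree of a nonempty finite graph $H$ is $2e(H)/|V(H)|$. Let $\Delta, n$ be non-negative integers, and let $G$ be a nonempty graph of maximum degree at most $\exp(\Delta/10^9)$ such that every nonempty subgraph of $G$ on at most $(10^7\Delta+1)n$ vertices has average degree at most $12/5$. Then: (1) If $G$ has minimum degree at least $10^7\Delta$, then $G$ contains every tree on $n$ vertices with maximum degree at most $\Delta$ as an induced subgraph. (2) More generally, let $J\subseteq G$ be any spanning subgraph of $G$ (i.e. $V(J)=V(G)$) with minimum degree at least $10^7\Delta$. Then for every tree $T$ on $n$ vertices with maximum degree at most $\Delta$, $J$ contains a copy of $T$ that is an induced subgraph of $G$; that is, there is an injection $\varphi:V(T)\to V(G)$ such that, for all $a,b\in V(T)$, if $ab\in E(T)$ then $\varphi(a)\varphi(b)\in E(J)$, and if $ab\notin E(T)$ then $\varphi(a)\varphi(b)\notin E(G)$. -/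

import Mathlib

/-- The average degree `2 e(H) / |V(H)|` of a subgraph `H` with finitely many vertices
(with value `0` for the subgraph without vertices). -/
noncomputable def SimpleGraph.Subgraph.averageDegree {V : Type*} {G : SimpleGraph V}
    (H : G.Subgraph) : ℝ :=
  2 * (H.edgeSet.ncard : ℝ) / (H.verts.ncard : ℝ)

/-- Every nonempty subgraph of `G` on at most `N` vertices has average degree at most `c`. -/
def SimpleGraph.SmallSubgraphsSparse {V : Type*} (G : SimpleGraph V) (N : ℕ) (c : ℝ) : Prop :=
  ∀ H : G.Subgraph, H.verts.Nonempty → H.verts.Finite → H.verts.ncard ≤ N → H.averageDegree ≤ c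

/-- The graph `J` (meant to be a subgraph of `G` on the same vertex set) contains a copy of `T`
which is an induced subgraph of `G`: an injection of the vertices of `T` under which every edge
of `T` becomes an edge of `J` and every non-edge of `T` becomes a non-edge of `G`. -/
def SimpleGraph.ContainsInducedIn {V W : Type*} (J G : SimpleGraph V) (T : SimpleGraph W) : Prop :=
  ∃ φ : T ↪g G, ∀ a b : W, T.Adj a b → J.Adj (φ a) (φ b)

/-!
Call a vertex set sparse if it spans at most `6/5` times as many edges as vertices;
all small sets are. The tree is embedded one leaf at a time. Each image vertex `p` takes its
children from a set `R p` of at least `Δ` neighbours which is fixed ("reserved") once and for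
all, at the latest when the first child of `p` is needed. The reserved sets are pairwise
disjoint, and the only edges between reserved vertices join a vertex `p` to `R p`; hence whatever
part of them is used, the tree spanned is induced, and a child is always available.

Only boundedly many vertices can be reserved for, and a vertex must not lose all its useful
neighbours before its turn. So a vertex is processed pre-emptively. Each processed vertex `p`
has a list `L p` of `20Δ` neighbours, inside which `R p` lies. A neighbour `u` of `v` is *tainted*
for `v` if it lies in, or has a neighbour other than `v` in, one of the lists, the root
of the tree counting as listed. As soon as
`1000Δ` neighbours of `v` are tainted, `v` is processed too. Two counts make this work.

* Few vertices are processed without a request: each brings `1000Δ` tainted neighbours, which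
  are processed or listed themselves or else have two neighbours among the processed and listed
  vertices, and many such vertices would violate sparsity (`mul_card_le_of_tainted`,
  `card_le_two_mul`). So the closure under the pre-emptive rule stays finite and small.
* When a request triggers a batch `Q` of new vertices, none of them was over the threshold before,
  so their lists can be chosen free of taint from the past, and conflicts arise only
  within the batch. By sparsity, in any subfamily of the batch some vertex sees conflicts on little
  more than two fifths of its list (`exists_few_conflicts`); deleting those and peeling off that
  vertex, and then continuing with the others, leaves at least `Δ` entries in every list
  (`exists_conflict_free`).
-/

namespace InducedTree
open Finset
open scoped Classical

/-! ### Counting adjacent pairs -/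

/-- The number of pairs `(a, b)` with `a ∈ s`, `b ∈ t` and `a` adjacent to `b`; in particular
`adjCount G s s` is twice the number of edges spanned by `s`. -/
noncomputable def adjCount {V : Type*} (G : SimpleGraph V) (s t : Finset V) : ℕ :=
  ∑ a ∈ s, #{b ∈ t | G.Adj a b}

variable {V : Type*} {G : SimpleGraph V}

theorem adjCount_comm (s t : Finset V) : adjCount G s t = adjCount G t s := by
  have h := Finset.sum_card_bipartiteAbove_eq_sum_card_bipartiteBelow (s := s) (t := t) G.Adj
  simpa [adjCount, Finset.bipartiteAbove, Finset.bipartiteBelow, G.adj_comm] using h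

theorem adjCount_union_left {s s' : Finset V} (h : Disjoint s s') (t : Finset V) :
    adjCount G (s ∪ s') t = adjCount G s t + adjCount G s' t :=
  Finset.sum_union h

theorem adjCount_union_right (s : Finset V) {t t' : Finset V} (h : Disjoint t t') :
    adjCount G s (t ∪ t') = adjCount G s t + adjCount G s t' := by
  rw [adjCount_comm, adjCount_union_left h, adjCount_comm t, adjCount_comm t']

/-- Every set of at most `N` vertices spans a graph of average degree at most `12 / 5`, in terms
of ordered adjacent pairs. -/
def PairSparse {V : Type*} (G : SimpleGraph V) (N : ℕ) : Prop :=
  ∀ s : Finset V, #s ≤ N → 5 * adjCount G s s ≤ 12 * #s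

theorem pairSparse_of_smallSubgraphsSparse {N : ℕ}
    (h : G.SmallSubgraphsSparse N (12 / 5)) : PairSparse G N := by
  intro s hs
  rcases s.eq_empty_or_nonempty with rfl | hne
  · simp [adjCount]
  have key := h ((⊤ : G.Subgraph).induce (s : Set V)) (by simpa using hne)
    (by simp) (by simpa using hs)
  set E := ((⊤ : G.Subgraph).induce (s : Set V)).edgeSet with hE
  set D : Finset (V × V) := {p ∈ s ×ˢ s | G.Adj p.1 p.2} with hD
  have hDcard : adjCount G s s = #D := by
    rw [adjCount, hD, Finset.card_filter, Finset.sum_product]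
    exact Finset.sum_congr rfl fun a _ => Finset.card_filter _ _
  have himg : ((D.image (fun p => s(p.1, p.2)) : Finset (Sym2 V)) : Set (Sym2 V)) = E := by
    ext e
    induction e with
    | h a b =>
      simp only [hE, hD, coe_image, coe_filter, mem_product, Set.mem_image, Set.mem_ofPred_eq,
        SimpleGraph.Subgraph.mem_edgeSet, SimpleGraph.Subgraph.induce_adj,
        SimpleGraph.Subgraph.top_adj, mem_coe, Prod.exists, Sym2.eq_iff]
      constructor
      · rintro ⟨x, y, ⟨⟨hx, hy⟩, hxy⟩, ⟨rfl, rfl⟩ | ⟨rfl, rfl⟩⟩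
        · exact ⟨hx, hy, hxy⟩
        · exact ⟨hy, hx, hxy.symm⟩
      · rintro ⟨ha, hb, hab⟩
        exact ⟨a, b, ⟨⟨ha, hb⟩, hab⟩, Or.inl ⟨rfl, rfl⟩⟩
  have hle : #D ≤ 2 * #(D.image (fun p => s(p.1, p.2))) := by
    refine Finset.card_le_mul_card_image D 2 ?_
    intro e _
    induction e with
    | h a b =>
      refine (Finset.card_le_card (t := {(a, b), (b, a)}) ?_).trans Finset.card_le_two
      rintro ⟨x, y⟩ hp
      simpa using (Finset.mem_filter.1 hp).2
  have hEn : E.ncard = #(D.image (fun p => s(p.1, p.2))) := by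
    rw [← himg, Set.ncard_coe_finset]
  have hpos : (0 : ℝ) < #s := by exact_mod_cast hne.card_pos
  rw [SimpleGraph.Subgraph.averageDegree, ← hE, hEn] at key
  simp only [SimpleGraph.Subgraph.induce_verts, Set.ncard_coe_finset] at key
  rw [div_le_div_iff₀ hpos (by norm_num)] at key
  have : 2 * #(D.image (fun p => s(p.1, p.2))) * 5 ≤ 12 * #s := by exact_mod_cast key
  omega

/-! ### The two consequences of sparsity -/

/-- Suppose each `v ∈ P` has `g` neighbours which lie in `B ⊇ P` or have a neighbour in `B` other
than `v`. Such neighbours outside `B` have two neighbours in `B`, so sparsity bounds the number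
of edges from them to `B` by `3 #B`; the others use up edges inside `B`. -/
theorem mul_card_le_of_tainted {N g : ℕ} (hG : PairSparse G N) {P B : Finset V} (hPB : P ⊆ B)
    (t : V → Finset V) (htcard : ∀ v ∈ P, #(t v) = g) (htadj : ∀ v ∈ P, ∀ u ∈ t v, G.Adj v u)
    (ht : ∀ v ∈ P, ∀ u ∈ t v, u ∈ B ∨ ∃ a ∈ B, a ≠ v ∧ G.Adj u a)
    (hN : #B + g * #P ≤ N) : 5 * (g * #P) ≤ 27 * #B := by
  set U := P.biUnion t \ B with hU
  have hUcard : #U ≤ g * #P := by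
    refine (Finset.card_le_card Finset.sdiff_subset).trans ?_
    rw [mul_comm]
    exact Finset.card_biUnion_le_card_mul _ _ _ fun v hv => (htcard v hv).le
  have hBU : Disjoint B U := Finset.disjoint_sdiff
  have hB := hG B (by omega)
  have hW := hG (B ∪ U) (by rw [card_union_of_disjoint hBU]; omega)
  rw [card_union_of_disjoint hBU, adjCount_union_left hBU, adjCount_union_right _ hBU,
    adjCount_union_right _ hBU, adjCount_comm U B] at hW
  have h2 : 2 * #U ≤ adjCount G B U := by
    rw [adjCount_comm, adjCount, mul_comm, ← smul_eq_mul]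
    refine Finset.card_nsmul_le_sum _ _ _ fun u hu => ?_
    obtain ⟨hu1, hu2⟩ := Finset.mem_sdiff.1 hu
    obtain ⟨v, hv, huv⟩ := Finset.mem_biUnion.1 hu1
    obtain ⟨a, ha, hav, hua⟩ := (ht v hv u huv).resolve_left hu2
    exact Finset.one_lt_card.2 ⟨a, by simp [ha, hua], v,
      by simp [hPB hv, (htadj v hv u huv).symm], hav⟩
  have hsplit : g * #P ≤ adjCount G B B + adjCount G B U := by
    rw [← adjCount_union_right _ hBU]
    calc g * #P = ∑ v ∈ P, g := by simp [mul_comm]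
      _ ≤ ∑ v ∈ P, #{u ∈ B ∪ U | G.Adj v u} := by
        refine Finset.sum_le_sum fun v hv => ?_
        rw [← htcard v hv]
        refine Finset.card_le_card fun u hu => ?_
        simp only [mem_filter, mem_union, hU, mem_sdiff, mem_biUnion]
        exact ⟨(em (u ∈ B)).imp id fun h => ⟨⟨v, hv, hu⟩, h⟩, htadj v hv u hu⟩
      _ ≤ _ := Finset.sum_le_sum_of_subset hPB
  omega

/-- Reserving `a` for `q` and `b` for `q'` is a conflict if `a = b` is shared by different owners,
or if `a` and `b` are adjacent and neither is the owner of the other. -/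
def Conflict {V : Type*} (G : SimpleGraph V) (q a q' b : V) : Prop :=
  (a = b ∧ q ≠ q') ∨ (G.Adj a b ∧ a ≠ q' ∧ b ≠ q)

/-- On average, the lists of a sparse family have conflicts on at most `2f/5 + 24/5` of their
`f` entries. A list entry `a` outside `S` is involved in a conflict only if it has at least two
neighbours in `S` or a neighbour among the other listed vertices, so all conflicts are paid for by
edges beyond the one edge per listed vertex that is needed anyway. -/
theorem exists_few_conflicts {N f : ℕ} (hG : PairSparse G N) {S : Finset V} (hS : S.Nonempty)
    (L : V → Finset V) (hcard : ∀ q ∈ S, #(L q) = f) (hadj : ∀ q ∈ S, ∀ a ∈ L q, G.Adj q a)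
    (hN : #S * (f + 1) ≤ N) :
    ∃ q ∈ S, 5 * #{a ∈ L q | ∃ q' ∈ S, ∃ b ∈ L q', Conflict G q a q' b} ≤ 2 * f + 24 := by
  set C : V → Finset V := fun q => {a ∈ L q | ∃ q' ∈ S, ∃ b ∈ L q', Conflict G q a q' b} with hC
  set U := S.biUnion L \ S with hU
  have hSU : Disjoint S U := Finset.disjoint_sdiff
  have hUcard : #U ≤ #S * f := (Finset.card_le_card Finset.sdiff_subset).trans
    (Finset.card_biUnion_le_card_mul _ _ _ fun v hv => (hcard v hv).le)
  have hN' : #S + #S * f ≤ N := by linarith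
  have hS1 := hG S (by omega)
  have hW := hG (S ∪ U) (by rw [card_union_of_disjoint hSU]; omega)
  rw [card_union_of_disjoint hSU, adjCount_union_left hSU, adjCount_union_right _ hSU,
    adjCount_union_right _ hSU, adjCount_comm S U] at hW
  have hsum : ∑ q ∈ S, #(C q) ≤ adjCount G S S + ∑ a ∈ U, #{q ∈ S | a ∈ C q} := by
    have h1 : ∀ q ∈ S, #(C q) ≤ #{a ∈ S | G.Adj q a} + #{a ∈ U | a ∈ C q} := by
      intro q hq
      rw [← card_union_of_disjoint (Finset.disjoint_filter_filter hSU)]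
      refine Finset.card_le_card fun a ha => ?_
      have haL := (Finset.mem_filter.1 ha).1
      by_cases haS : a ∈ S
      · simp [haS, hadj q hq a haL]
      · simp only [mem_union, mem_filter, hU, mem_sdiff, mem_biUnion]
        exact Or.inr ⟨⟨⟨q, hq, haL⟩, haS⟩, ha⟩
    refine (Finset.sum_le_sum h1).trans ?_
    rw [Finset.sum_add_distrib]
    refine Nat.add_le_add_left (le_of_eq ?_) _
    exact Finset.sum_card_bipartiteAbove_eq_sum_card_bipartiteBelow (s := S) (t := U)
      (fun q a => a ∈ C q)
  -- Each `a ∈ U` has an owner in `S`; without a second neighbour in `S` it has one owner only, and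
  -- then a conflict forces a neighbour in `U`.
  have hpt : ∀ a ∈ U, #{q ∈ S | a ∈ C q} + 2 ≤
      2 * #{q ∈ S | G.Adj a q} + #{b ∈ U | G.Adj a b} := by
    intro a ha
    obtain ⟨ha1, haS⟩ := Finset.mem_sdiff.1 ha
    obtain ⟨p, hp, hap⟩ := Finset.mem_biUnion.1 ha1
    have hsub : #{q ∈ S | a ∈ C q} ≤ #{q ∈ S | G.Adj a q} :=
      Finset.card_le_card fun q hq => by
        obtain ⟨hq1, hq2⟩ := Finset.mem_filter.1 hq
        exact Finset.mem_filter.2 ⟨hq1, (hadj q hq1 a (Finset.mem_filter.1 hq2).1).symm⟩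
    have hpos : 0 < #{q ∈ S | G.Adj a q} :=
      Finset.card_pos.2 ⟨p, Finset.mem_filter.2 ⟨hp, (hadj p hp a hap).symm⟩⟩
    by_cases hdeg : 1 < #{q ∈ S | G.Adj a q}
    · omega
    have hone : ∀ x ∈ S, G.Adj a x → ∀ y ∈ S, G.Adj a y → x = y := by
      intro x hx hax y hy hay
      by_contra hne
      exact hdeg (Finset.one_lt_card.2 ⟨x, by simp [hx, hax], y, by simp [hy, hay], hne⟩)
    rcases Finset.eq_empty_or_nonempty {q ∈ S | a ∈ C q} with h0 | ⟨q, hq⟩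
    · rw [h0]; simp only [card_empty]; omega
    obtain ⟨hqS, hqC⟩ := Finset.mem_filter.1 hq
    obtain ⟨haq, q', hq', b, hb, hconf⟩ := Finset.mem_filter.1 hqC
    have : 0 < #{b ∈ U | G.Adj a b} := by
      refine Finset.card_pos.2 ⟨b, Finset.mem_filter.2 ?_⟩
      rcases hconf with ⟨rfl, hne⟩ | ⟨hab, haq', hbq⟩
      · exact absurd (hone q hqS (hadj q hqS a haq).symm q' hq' (hadj q' hq' a hb).symm) hne
      · refine ⟨Finset.mem_sdiff.2 ⟨Finset.mem_biUnion.2 ⟨q', hq', hb⟩, fun hbS => hbq ?_⟩, hab⟩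
        exact hone b hbS hab q hqS (hadj q hqS a haq).symm
    omega
  have hsumU : ∑ a ∈ U, #{q ∈ S | a ∈ C q} + 2 * #U ≤ 2 * adjCount G U S + adjCount G U U := by
    have := Finset.sum_le_sum hpt
    simp only [Finset.sum_add_distrib, ← Finset.mul_sum, Finset.sum_const, smul_eq_mul] at this
    simp only [adjCount]
    omega
  by_contra! hcon
  have hlt : ∑ q ∈ S, (2 * f + 24) < ∑ q ∈ S, 5 * #(C q) :=
    Finset.sum_lt_sum_of_nonempty hS hcon
  rw [← Finset.mul_sum, Finset.sum_const, smul_eq_mul] at hlt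
  have : #S * (2 * f + 24) = 2 * (#S * f) + 24 * #S := by ring
  omega

/-- Every list of length `f` can be thinned to at least `k` entries so that no conflict remains:
the vertex with few conflicts gives up all its entries in conflict, and the others recurse without
it. -/
theorem exists_conflict_free {N f k : ℕ} (hG : PairSparse G N) (L : V → Finset V)
    (hk : 5 * k + 24 ≤ 3 * f) (S : Finset V)
    (hcard : ∀ q ∈ S, #(L q) = f) (hadj : ∀ q ∈ S, ∀ a ∈ L q, G.Adj q a)
    (hN : #S * (f + 1) ≤ N) :
    ∃ R : V → Finset V, (∀ q ∈ S, R q ⊆ L q ∧ k ≤ #(R q)) ∧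
      ∀ q ∈ S, ∀ q' ∈ S, ∀ a ∈ R q, ∀ b ∈ R q', ¬ Conflict G q a q' b := by
  induction S using Finset.strongInduction with
  | H S ih =>
  rcases S.eq_empty_or_nonempty with rfl | hS
  · exact ⟨L, by simp, by simp⟩
  obtain ⟨q, hq, hfew⟩ := exists_few_conflicts hG hS L hcard hadj hN
  obtain ⟨R, hR, hRc⟩ := ih (S.erase q) (Finset.erase_ssubset hq)
    (fun p hp => hcard p (Finset.mem_of_mem_erase hp))
    (fun p hp => hadj p (Finset.mem_of_mem_erase hp))
    ((Nat.mul_le_mul_right _ (Finset.card_le_card (Finset.erase_subset _ _))).trans hN)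
  set K : Finset V := {a ∈ L q | ¬ ∃ q' ∈ S, ∃ b ∈ L q', Conflict G q a q' b} with hK
  have hKcard : k ≤ #K := by
    have hsplit : #{a ∈ L q | ∃ q' ∈ S, ∃ b ∈ L q', Conflict G q a q' b} + #K = f := by
      rw [hK, ← hcard q hq]
      convert Finset.card_filter_add_card_filter_not (s := L q)
        (fun a => ∃ q' ∈ S, ∃ b ∈ L q', Conflict G q a q' b)
    omega
  have hsub : ∀ p ∈ S, Function.update R q K p ⊆ L p ∧ k ≤ #(Function.update R q K p) := by
    intro p hp
    by_cases hpq : p = q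
    · subst hpq
      simpa using ⟨Finset.filter_subset _ _, hKcard⟩
    · simpa [hpq] using hR p (Finset.mem_erase.2 ⟨hpq, hp⟩)
  have hKnot : ∀ a ∈ K, ∀ p ∈ S, ∀ b ∈ L p, ¬ Conflict G q a p b := fun a ha p hp b hb hc =>
    (Finset.mem_filter.1 ha).2 ⟨p, hp, b, hb, hc⟩
  refine ⟨Function.update R q K, hsub, fun p hp p' hp' a ha b hb hc => ?_⟩
  by_cases hpq : p = q
  · subst hpq
    rw [Function.update_self] at ha
    exact hKnot a ha p' hp' b ((hsub p' hp').1 hb) hc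
  by_cases hpq' : p' = q
  · subst hpq'
    rw [Function.update_self] at hb
    refine hKnot b hb p hp a ((hsub p hp).1 ha) ?_
    exact hc.imp (fun h => ⟨h.1.symm, h.2.symm⟩) fun h => ⟨h.1.symm, h.2.2, h.2.1⟩
  rw [Function.update_of_ne hpq] at ha
  rw [Function.update_of_ne hpq'] at hb
  exact hRc p (Finset.mem_erase.2 ⟨hpq, hp⟩) p' (Finset.mem_erase.2 ⟨hpq', hp'⟩) a ha b hb hc

/-! ### Reservations -/

/-- A neighbour `u` of `v` is tainted by `A` if it lies in `A` or is adjacent to an element of `A`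
other than `v`. The exception for `v` is needed since `v` may itself lie in `A`. -/
def Tainted {V : Type*} (G : SimpleGraph V) (A : Finset V) (v u : V) : Prop :=
  u ∈ A ∨ ∃ a ∈ A, a ≠ v ∧ G.Adj u a

theorem Tainted.mono {A B : Finset V} (h : A ⊆ B) {v u : V} (hu : Tainted G A v u) :
    Tainted G B v u :=
  hu.imp (fun hA => h hA) fun ⟨a, ha, hav⟩ => ⟨a, h ha, hav⟩

/-- The number of tainted vertices in the neighbourhood `nb v`. -/
noncomputable def taint {V : Type*} (G : SimpleGraph V) (nb : V → Finset V) (A : Finset V)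
    (v : V) : ℕ :=
  #{u ∈ nb v | Tainted G A v u}

theorem taint_mono {nb : V → Finset V} {A B : Finset V} (h : A ⊆ B) (v : V) :
    taint G nb A v ≤ taint G nb B v :=
  Finset.card_le_card (Finset.monotone_filter_right _ fun _ _ hu => hu.mono h)

/-- The root `r` together with all vertices listed for some element of `P`. -/
noncomputable def candidates {V : Type*} (r : V) (L : V → Finset V) (P : Finset V) : Finset V :=
  insert r (P.biUnion L)

theorem candidates_mono (r : V) (L : V → Finset V) {P Q : Finset V} (h : P ⊆ Q) :
    candidates r L P ⊆ candidates r L Q :=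
  Finset.insert_subset_insert _ (Finset.biUnion_subset_biUnion_of_subset_left _ h)

theorem card_candidates_le (r : V) {L : V → Finset V} {P : Finset V} {f : ℕ}
    (h : ∀ v ∈ P, #(L v) = f) : #(candidates r L P) ≤ #P * f + 1 :=
  (Finset.card_insert_le _ _).trans
    (Nat.add_le_add_right (Finset.card_biUnion_le_card_mul _ _ _ fun v hv => (h v hv).le) 1)

theorem mul_card_le_of_taint {N g : ℕ} (hG : PairSparse G N) {nb : V → Finset V}
    (hnb : ∀ v, ∀ u ∈ nb v, G.Adj v u) {M B A : Finset V} (hMB : M ⊆ B) (hAB : A ⊆ B)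
    (hg : ∀ v ∈ M, g ≤ taint G nb A v) (hN : #B + g * #M ≤ N) : 5 * (g * #M) ≤ 27 * #B := by
  have hex : ∀ v, ∃ s : Finset V, v ∈ M → s ⊆ {u ∈ nb v | Tainted G A v u} ∧ #s = g := by
    intro v
    by_cases hv : v ∈ M
    · obtain ⟨s, hs⟩ := Finset.exists_subset_card_eq (hg v hv)
      exact ⟨s, fun _ => hs⟩
    · exact ⟨∅, fun h => absurd h hv⟩
  choose t ht using hex
  refine mul_card_le_of_tainted hG hMB t (fun v hv => (ht v hv).2) (fun v hv u hu => ?_)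
    (fun v hv u hu => ?_) hN
  · exact hnb v u (Finset.mem_filter.1 ((ht v hv).1 hu)).1
  · exact (Finset.mem_filter.1 ((ht v hv).1 hu)).2.mono hAB

/-- At most `n` vertices are processed without a request, since each of them sees `1000 * Δ` tainted
neighbours. The bound `2 * n + 1` in the hypothesis keeps the sets small enough for sparsity; it is
all that adding vertices one at a time requires. -/
theorem card_le_two_mul {N n Δ : ℕ} (hG : PairSparse G N) (hn : 1 ≤ n) (hΔ : 1 ≤ Δ)
    (hN : 4000 * Δ * n ≤ N) {nb : V → Finset V} (hnb : ∀ v, ∀ u ∈ nb v, G.Adj v u) {r : V}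
    {L : V → Finset V} {P D : Finset V} (hD : #D ≤ n) (hP : #P ≤ 2 * n + 1)
    (hL : ∀ v ∈ P, #(L v) = 20 * Δ)
    (hforced : ∀ v ∈ P, v ∉ D → 1000 * Δ ≤ taint G nb (candidates r L P) v) : #P ≤ 2 * n := by
  by_contra! hlt
  have hB : #(P ∪ candidates r L P) ≤ #P + (#P * (20 * Δ) + 1) :=
    (Finset.card_union_le _ _).trans (Nat.add_le_add_left (card_candidates_le r hL) _)
  have hM : n ≤ #(P \ D) := by
    have := Finset.le_card_sdiff D P
    omega
  have hM' : #(P \ D) ≤ 3 * n := (Finset.card_le_card Finset.sdiff_subset).trans (by omega)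
  have hB' : #(P ∪ candidates r L P) ≤ 64 * (Δ * n) := by
    have hnΔ : n ≤ Δ * n := Nat.le_mul_of_pos_left n hΔ
    have : #P * (20 * Δ) ≤ 3 * n * (20 * Δ) := Nat.mul_le_mul_right _ (by omega)
    have h60 : 3 * n * (20 * Δ) = 60 * (Δ * n) := by ring
    omega
  have h1 : 1000 * Δ * n ≤ 1000 * Δ * #(P \ D) := Nat.mul_le_mul_left _ hM
  have h2 : 1000 * Δ * #(P \ D) ≤ 1000 * Δ * (3 * n) := Nat.mul_le_mul_left _ hM'
  have h3 : 1000 * Δ * (3 * n) = 3000 * (Δ * n) := by ring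
  have h4 : 1000 * Δ * n = 1000 * (Δ * n) := by ring
  have h5 : 4000 * Δ * n = 4000 * (Δ * n) := by ring
  have hpos : 0 < Δ * n := Nat.mul_pos hΔ hn
  have := mul_card_le_of_taint (g := 1000 * Δ) hG hnb (M := P \ D)
    (B := P ∪ candidates r L P) (A := candidates r L P)
    (Finset.sdiff_subset.trans Finset.subset_union_left) Finset.subset_union_right
    (fun v hv => hforced v (Finset.mem_sdiff.1 hv).1 (Finset.mem_sdiff.1 hv).2) (by omega)
  omega

/-- The state of the embedding procedure with root `r`: `P` is the set of processed vertices, `D`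
the subset of those which were processed on request, `L v` the list of `v ∈ P` and `R v` the set
of vertices reserved as children of `v`. The values of `L` and `R` outside `P` are irrelevant.
The neighbourhoods `nb v` are those from which children may be taken; in the application, the
neighbourhoods in the spanning subgraph. By `forced` and `free`, the vertices processed without a
request are over the taint threshold and the unprocessed ones are below it. -/
structure IsReservation {V : Type*} (G : SimpleGraph V) (nb : V → Finset V) (n Δ : ℕ) (r : V)
    (P D : Finset V) (L R : V → Finset V) : Prop where
  subset : D ⊆ P
  card_le : #P ≤ 2 * n
  list_subset : ∀ v ∈ P, L v ⊆ nb v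
  list_card : ∀ v ∈ P, #(L v) = 20 * Δ
  reserved_subset : ∀ v ∈ P, R v ⊆ L v
  le_card_reserved : ∀ v ∈ P, Δ ≤ #(R v)
  not_conflict : ∀ p ∈ P, ∀ q ∈ P, ∀ a ∈ R p, ∀ b ∈ R q, ¬ Conflict G p a q b
  root : ∀ p ∈ P, ∀ b ∈ R p, b ≠ r ∧ (G.Adj b r → p = r)
  forced : ∀ v ∈ P, v ∉ D → 1000 * Δ ≤ taint G nb (candidates r L P) v
  free : ∀ v, v ∉ P → taint G nb (candidates r L P) v < 1000 * Δ

/-- Before the first request no vertex is over the threshold, as two vertices have few common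
neighbours in a sparse graph. -/
theorem isReservation_empty {N n Δ : ℕ} (hG : PairSparse G N) (hn : 1 ≤ n) (hΔ : 1 ≤ Δ)
    (hN : 4000 * Δ * n ≤ N) {nb : V → Finset V} (hnb : ∀ v, ∀ u ∈ nb v, G.Adj v u) (r : V)
    (L R : V → Finset V) : IsReservation G nb n Δ r ∅ ∅ L R where
  subset := Finset.Subset.refl _
  card_le := by simp
  list_subset := by simp
  list_card := by simp
  reserved_subset := by simp
  le_card_reserved := by simp
  not_conflict := by simp
  root := by simp
  forced := by simp
  free := fun v _ => by
    by_contra! hv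
    have hB : #({v, r} : Finset V) ≤ 2 := Finset.card_le_two
    have hΔn : Δ * 1 ≤ Δ * n := Nat.mul_le_mul_left _ hn
    have h5 : 4000 * Δ * n = 4000 * (Δ * n) := by ring
    have := mul_card_le_of_taint (g := 1000 * Δ) hG hnb (M := {v}) (B := {v, r})
      (A := candidates r L ∅) (by simp) (by simp [candidates]) (by simpa using hv)
      (by simp only [card_singleton]; omega)
    simp only [card_singleton] at this
    omega

/-- A request for `x` can be granted without changing existing reservations: close `P` and `x`
under the pre-emptive rule, then resolve the conflicts within the new batch. -/
theorem IsReservation.extend {N n Δ : ℕ} (hG : PairSparse G N) (hn : 1 ≤ n) (hΔ : 1 ≤ Δ)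
    (hN : 4000 * Δ * n ≤ N) {nb : V → Finset V} (hnb : ∀ v, ∀ u ∈ nb v, G.Adj v u)
    (hdeg : ∀ v, 2000 * Δ ≤ #(nb v)) {r : V} {P D : Finset V} {L R : V → Finset V}
    (h : IsReservation G nb n Δ r P D L R) (hD : #D < n) (x : V) :
    ∃ P' L' R', IsReservation G nb n Δ r P' (insert x D) L' R' ∧ P ⊆ P' ∧ ∀ v ∈ P, R' v = R v := by
  have hex : ∀ v, ∃ s : Finset V, (v ∈ P → s = L v) ∧
      (v ∉ P → s ⊆ {u ∈ nb v | ¬ Tainted G (candidates r L P) v u} ∧ #s = 20 * Δ) := by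
    intro v
    by_cases hv : v ∈ P
    · exact ⟨L v, fun _ => rfl, fun h' => absurd hv h'⟩
    · have hsplit : taint G nb (candidates r L P) v +
          #{u ∈ nb v | ¬ Tainted G (candidates r L P) v u} = #(nb v) := by
        rw [taint]
        convert Finset.card_filter_add_card_filter_not (s := nb v)
          (fun u => Tainted G (candidates r L P) v u)
      have h1 := h.free v hv
      have h2 := hdeg v
      obtain ⟨s, hs⟩ := Finset.exists_subset_card_eq
        (s := {u ∈ nb v | ¬ Tainted G (candidates r L P) v u}) (n := 20 * Δ) (by omega)
      exact ⟨s, fun h' => absurd h' hv, fun _ => hs⟩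
  choose L' hL'P hL'n using hex
  have hcand : candidates r L' P = candidates r L P := by
    rw [candidates, candidates, Finset.biUnion_congr rfl hL'P]
  have hL'card : ∀ v, #(L' v) = 20 * Δ := fun v => by
    by_cases hv : v ∈ P
    · rw [hL'P v hv, h.list_card v hv]
    · exact (hL'n v hv).2
  have hL'sub : ∀ v, L' v ⊆ nb v := fun v => by
    by_cases hv : v ∈ P
    · rw [hL'P v hv]; exact h.list_subset v hv
    · exact (hL'n v hv).1.trans (Finset.filter_subset _ _)
  have hD' : #(insert x D) ≤ n := (Finset.card_insert_le _ _).trans hD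
  -- The closure under the pre-emptive rule is obtained as a largest set, of size at most `2 * n`,
  -- in which only requested vertices are below the threshold.
  let good : Finset V → Prop := fun Q => P ⊆ Q ∧ x ∈ Q ∧ #Q ≤ 2 * n ∧
    ∀ v ∈ Q, v ∉ insert x D → 1000 * Δ ≤ taint G nb (candidates r L' Q) v
  have hstep : ∀ Q v, P ⊆ Q → #Q ≤ 2 * n → x ∈ insert v Q →
      (∀ w ∈ insert v Q, w ∉ insert x D →
        1000 * Δ ≤ taint G nb (candidates r L' (insert v Q)) w) → good (insert v Q) := by
    intro Q v hPQ hQ hxQ hf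
    refine ⟨hPQ.trans (Finset.subset_insert _ _), hxQ, ?_, hf⟩
    exact card_le_two_mul hG hn hΔ hN hnb hD'
      ((Finset.card_insert_le _ _).trans (by omega)) (fun w _ => hL'card w) hf
  have hgood0 : good (insert x P) := by
    refine hstep P x (Finset.Subset.refl _) h.card_le (Finset.mem_insert_self _ _)
      fun w hw hwD => ?_
    have hwx : w ≠ x := fun e => hwD (e ▸ Finset.mem_insert_self _ _)
    refine (h.forced w ((Finset.mem_insert.1 hw).resolve_left hwx)
      fun hwD' => hwD (Finset.mem_insert_of_mem hwD')).trans ?_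
    rw [← hcand]
    exact taint_mono (candidates_mono _ _ (Finset.subset_insert _ _)) w
  obtain ⟨Q, hQ, hmax⟩ : ∃ Q, good Q ∧ ∀ Q', good Q' → #Q' ≤ #Q := by
    have hfin : {m | ∃ Q, good Q ∧ #Q = m}.Finite :=
      (Set.finite_le_nat (2 * n)).subset (by rintro m ⟨Q, hQ, rfl⟩; exact hQ.2.2.1)
    obtain ⟨m, ⟨Q, hQ, rfl⟩, hm⟩ := Set.exists_max_image _ id hfin ⟨_, _, hgood0, rfl⟩
    exact ⟨Q, hQ, fun Q' hQ' => hm _ ⟨Q', hQ', rfl⟩⟩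
  obtain ⟨hPQ, hxQ, hQcard, hQf⟩ := hQ
  have hsmall : #(Q \ P) * (20 * Δ + 1) ≤ N := by
    have h1 : #(Q \ P) ≤ 2 * n := (Finset.card_le_card Finset.sdiff_subset).trans hQcard
    calc #(Q \ P) * (20 * Δ + 1) ≤ 2 * n * (2000 * Δ) := Nat.mul_le_mul h1 (by omega)
      _ = 4000 * Δ * n := by ring
      _ ≤ N := hN
  obtain ⟨R₁, hR₁, hR₁c⟩ := exists_conflict_free (k := Δ) hG L' (by omega) (Q \ P)
    (fun v _ => hL'card v) (fun v _ a ha => hnb v a (hL'sub v ha)) hsmall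
  set R' : V → Finset V := fun v => if v ∈ P then R v else R₁ v with hR'
  have hR'P : ∀ v ∈ P, R' v = R v := fun v hv => if_pos hv
  have hR'n : ∀ v, v ∉ P → R' v = R₁ v := fun v hv => if_neg hv
  -- New reservations avoid the taint of everything listed earlier, so they are not in conflict
  -- with the earlier reservations.
  have hnew : ∀ q ∈ Q, q ∉ P → ∀ b ∈ R' q, ¬ Tainted G (candidates r L P) q b := by
    intro q hq hqP b hb
    rw [hR'n q hqP] at hb
    exact (Finset.mem_filter.1 ((hL'n q hqP).1
      ((hR₁ q (Finset.mem_sdiff.2 ⟨hq, hqP⟩)).1 hb))).2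
  have hold : ∀ p ∈ P, ∀ a ∈ R' p, a ∈ candidates r L P := by
    intro p hp a ha
    rw [hR'P p hp] at ha
    exact Finset.mem_insert_of_mem (Finset.mem_biUnion.2 ⟨p, hp, h.reserved_subset p hp ha⟩)
  refine ⟨Q, L', R', ⟨?_, hQcard, fun v _ => hL'sub v, fun v _ => hL'card v, ?_, ?_, ?_, ?_,
    hQf, ?_⟩, hPQ, hR'P⟩
  · exact Finset.insert_subset hxQ (h.subset.trans hPQ)
  · intro v hv
    by_cases hvP : v ∈ P
    · rw [hR'P v hvP, hL'P v hvP]; exact h.reserved_subset v hvP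
    · rw [hR'n v hvP]; exact (hR₁ v (Finset.mem_sdiff.2 ⟨hv, hvP⟩)).1
  · intro v hv
    by_cases hvP : v ∈ P
    · rw [hR'P v hvP]; exact h.le_card_reserved v hvP
    · rw [hR'n v hvP]; exact (hR₁ v (Finset.mem_sdiff.2 ⟨hv, hvP⟩)).2
  · intro p hp q hq a ha b hb hc
    by_cases hpP : p ∈ P <;> by_cases hqP : q ∈ P
    · rw [hR'P _ hpP] at ha
      rw [hR'P _ hqP] at hb
      exact h.not_conflict p hpP q hqP a ha b hb hc
    · refine hnew q hq hqP b hb ?_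
      rcases hc with ⟨rfl, -⟩ | ⟨hab, haq, -⟩
      · exact Or.inl (hold p hpP a ha)
      · exact Or.inr ⟨a, hold p hpP a ha, haq, hab.symm⟩
    · refine hnew p hp hpP a ha ?_
      rcases hc with ⟨rfl, -⟩ | ⟨hab, -, hbp⟩
      · exact Or.inl (hold q hqP a hb)
      · exact Or.inr ⟨b, hold q hqP b hb, hbp, hab⟩
    · rw [hR'n _ hpP] at ha
      rw [hR'n _ hqP] at hb
      exact hR₁c p (Finset.mem_sdiff.2 ⟨hp, hpP⟩) q (Finset.mem_sdiff.2 ⟨hq, hqP⟩) a ha b hb hc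
  · intro p hp b hb
    by_cases hpP : p ∈ P
    · rw [hR'P _ hpP] at hb
      exact h.root p hpP b hb
    · have hr : r ∈ candidates r L P := Finset.mem_insert_self _ _
      have hnt := hnew p hp hpP b hb
      refine ⟨fun e => hnt (Or.inl (e ▸ hr)), fun hbr => ?_⟩
      by_contra hpr
      exact hnt (Or.inr ⟨r, hr, Ne.symm hpr, hbr⟩)
  · intro v hv
    by_contra! hge
    have := hmax _ (hstep Q v hPQ hQcard (Finset.mem_insert_of_mem hxQ) fun w hw hwD => ?_)
    · rw [Finset.card_insert_of_notMem hv] at this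
      omega
    · have hmono := taint_mono (G := G) (nb := nb)
        (candidates_mono r L' (Finset.subset_insert v Q)) w
      rcases Finset.mem_insert.1 hw with rfl | hw
      · exact hge.trans hmono
      · exact (hQf w hw hwD).trans hmono

/-! ### Embedding the tree -/

/-- In an acyclic graph, a vertex outside a connected set has at most one neighbour in it. -/
theorem eq_of_adj_of_notMem {W : Type*} {T : SimpleGraph W} (hT : T.IsAcyclic) {S : Set W}
    (hS : (T.induce S).Connected) {x s t : W} (hx : x ∉ S) (hs : s ∈ S) (ht : t ∈ S)
    (hxs : T.Adj x s) (hxt : T.Adj x t) : s = t := by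
  obtain ⟨w, hw⟩ := (hS.preconnected ⟨s, hs⟩ ⟨t, ht⟩).exists_isPath
  let p : T.Walk s t := w.map (SimpleGraph.Embedding.induce (G := T) S).toHom
  have hp : p.IsPath := hw.map Subtype.val_injective
  have hxp : x ∉ p.support := by
    intro h
    rw [show p.support = _ from SimpleGraph.Walk.support_map _ w] at h
    obtain ⟨y, -, rfl⟩ := List.mem_map.1 h
    exact hx y.2
  -- The path from `x` through `s` to `t` must be the edge from `x` to `t`.
  have heq := (hT.subsingleton_path x t).elim ⟨SimpleGraph.Walk.cons hxs p, hp.cons hxp⟩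
    (SimpleGraph.Path.singleton hxt)
  have hlen := congrArg (fun q : T.Path x t => (q : T.Walk x t).length) heq
  simp only [SimpleGraph.Walk.length_cons, SimpleGraph.Path.singleton,
    SimpleGraph.Walk.length_nil] at hlen
  exact SimpleGraph.Walk.eq_of_length_eq_zero (p := p) (by omega)

theorem exists_boundary_edge {W : Type*} {T : SimpleGraph W} (hT : T.Connected) {S : Set W}
    (hS : (T.induce S).Connected) (hne : S ≠ Set.univ) :
    ∃ t ∈ S, ∃ x ∉ S, T.Adj t x ∧ (T.induce (insert x S)).Connected := by
  obtain ⟨⟨s, hs⟩⟩ := hS.nonempty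
  obtain ⟨y, hy⟩ := (Set.ne_univ_iff_exists_notMem S).1 hne
  obtain ⟨w⟩ := hT.preconnected s y
  obtain ⟨d, -, hd1, hd2⟩ := w.exists_boundary_dart S hs hy
  refine ⟨d.fst, hd1, d.snd, hd2, d.adj, ?_⟩
  have := SimpleGraph.connected_induce_union (G := T) (s := S) (t := {d.snd}) hS.preconnected
    (by
      have : Subsingleton ({d.snd} : Set W) := Set.subsingleton_singleton.coe_sort
      exact SimpleGraph.Preconnected.of_subsingleton) hd1 (Set.mem_singleton _) d.adj
  rwa [Set.union_singleton] at this

/-- An embedding `φ` of the subtree on `S` all of whose vertices except the root `r` are reserved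
children of vertices in the image. The field `edge` is symmetric because `nb` need not be;
membership in one direction suffices for adjacency in the spanning subgraph. -/
structure IsPartialEmbedding {V W : Type*} (G : SimpleGraph V) (nb : V → Finset V)
    (T : SimpleGraph W) (n Δ : ℕ) (r : V) (S : Finset W) (φ : W → V) (P D : Finset V)
    (L R : V → Finset V) : Prop where
  reservation : IsReservation G nb n Δ r P D L R
  card_lt : #D < #S
  connected : (T.induce (S : Set W)).Connected
  injOn : Set.InjOn φ S
  adj_iff : ∀ s ∈ S, ∀ t ∈ S, G.Adj (φ s) (φ t) ↔ T.Adj s t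
  edge : ∀ s ∈ S, ∀ t ∈ S, T.Adj s t → φ t ∈ nb (φ s) ∨ φ s ∈ nb (φ t)
  parent : ∀ s ∈ S, φ s = r ∨ ∃ s' ∈ S, φ s' ∈ P ∧ φ s ∈ R (φ s')

/-- A vertex `x` adjacent to `t ∈ S` is mapped to an element of `R (φ t)` outside the image of `S`.
One exists because image vertices in `R (φ t)` come from neighbours of `t` other than `x`, of which
there are fewer than `Δ`. -/
theorem IsPartialEmbedding.extend {W : Type*} [Fintype W] {T : SimpleGraph W} [T.LocallyFinite]
    (hT : T.IsTree) {N Δ : ℕ} (hG : PairSparse G N) (hΔ : 1 ≤ Δ)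
    (hTΔ : ∀ w, T.degree w ≤ Δ) (hN : 4000 * Δ * Fintype.card W ≤ N) {nb : V → Finset V}
    (hnb : ∀ v, ∀ u ∈ nb v, G.Adj v u) (hdeg : ∀ v, 2000 * Δ ≤ #(nb v)) {r : V}
    {S : Finset W} {φ : W → V} {P D : Finset V} {L R : V → Finset V}
    (h : IsPartialEmbedding G nb T (Fintype.card W) Δ r S φ P D L R)
    (hS : #S < Fintype.card W) :
    ∃ S' φ' P' D' L' R', #S' = #S + 1 ∧
      IsPartialEmbedding G nb T (Fintype.card W) Δ r S' φ' P' D' L' R' := by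
  obtain ⟨t, ht, x, hx, htx, hconn⟩ := exists_boundary_edge hT.connected h.connected (by
    rintro e
    rw [Finset.coe_eq_univ] at e
    rw [e, Finset.card_univ] at hS
    exact lt_irrefl _ hS)
  rw [Finset.mem_coe] at ht hx
  have honly : ∀ s ∈ S, T.Adj s x ↔ s = t := fun s hs =>
    ⟨fun hsx => eq_of_adj_of_notMem hT.isAcyclic h.connected (mt Finset.mem_coe.1 hx)
      (Finset.mem_coe.2 hs) (Finset.mem_coe.2 ht) hsx.symm htx.symm, fun e => e ▸ htx⟩
  obtain ⟨P', L', R', hres, hPP', hRR'⟩ := h.reservation.extend hG (by omega) hΔ hN hnb hdeg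
    (h.card_lt.trans hS) (φ t)
  have hparent : ∀ s ∈ S, φ s = r ∨ ∃ s' ∈ S, φ s' ∈ P' ∧ φ s ∈ R' (φ s') := fun s hs =>
    (h.parent s hs).imp id fun ⟨s', hs', hP, hR⟩ => ⟨s', hs', hPP' hP, by rwa [hRR' _ hP]⟩
  have htP : φ t ∈ P' := hres.subset (Finset.mem_insert_self _ _)
  have hnbR : ∀ p ∈ P', ∀ a ∈ R' p, a ∈ nb p := fun p hp a ha =>
    hres.list_subset p hp (hres.reserved_subset p hp ha)
  have hused : #(S.image φ ∩ R' (φ t)) < #(R' (φ t)) := by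
    have hsub : S.image φ ∩ R' (φ t) ⊆ ((T.neighborFinset t).erase x).image φ := by
      intro a ha
      obtain ⟨ha, haR⟩ := Finset.mem_inter.1 ha
      obtain ⟨s, hs, rfl⟩ := Finset.mem_image.1 ha
      refine Finset.mem_image_of_mem _ (Finset.mem_erase.2 ⟨fun e => hx (e ▸ hs), ?_⟩)
      rw [SimpleGraph.mem_neighborFinset]
      exact (h.adj_iff t ht s hs).1 (hnb _ _ (hnbR _ htP _ haR))
    have hxt : x ∈ T.neighborFinset t := (SimpleGraph.mem_neighborFinset _ _ _).2 htx
    have h1 := (Finset.card_le_card hsub).trans Finset.card_image_le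
    rw [Finset.card_erase_of_mem hxt, SimpleGraph.card_neighborFinset_eq_degree] at h1
    have h2 := hTΔ t
    have h3 := hres.le_card_reserved _ htP
    omega
  obtain ⟨a, haR, ha⟩ := Finset.exists_mem_notMem_of_card_lt_card hused
  have haS : ∀ s ∈ S, φ s ≠ a := fun s hs e =>
    ha (Finset.mem_inter.2 ⟨Finset.mem_image.2 ⟨s, hs, e⟩, haR⟩)
  have hadj : ∀ s ∈ S, G.Adj (φ s) a ↔ T.Adj s x := by
    intro s hs
    rw [honly s hs]
    refine ⟨fun hsa => ?_, fun e => e ▸ hnb _ _ (hnbR _ htP _ haR)⟩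
    rcases hparent s hs with hr | ⟨s', hs', hP, hR⟩
    · rw [hr] at hsa
      exact h.injOn hs ht (hr.trans ((hres.root _ htP a haR).2 hsa.symm).symm)
    -- If `φ s` is reserved for `φ s'`, then adjacency to `a` forces `a = φ s'`, which is excluded
    -- since `a` is new, or `φ s = φ t`.
    · by_contra hst
      exact hres.not_conflict _ htP _ hP a haR _ hR (Or.inr ⟨hsa.symm, (haS s' hs').symm,
        fun e => hst (h.injOn hs ht e)⟩)
  have hφx : Function.update φ x a x = a := Function.update_self _ _ _
  have hφS : ∀ s ∈ S, Function.update φ x a s = φ s := fun s hs =>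
    Function.update_of_ne (ne_of_mem_of_not_mem hs hx) _ _
  refine ⟨insert x S, Function.update φ x a, P', insert (φ t) D, L', R',
    Finset.card_insert_of_notMem hx, ⟨hres, ?_, (Finset.coe_insert x S).symm ▸ hconn, ?_, ?_, ?_, ?_⟩⟩
  · rw [Finset.card_insert_of_notMem hx]
    exact (Finset.card_insert_le _ _).trans_lt (Nat.add_lt_add_right h.card_lt 1)
  · rw [Finset.coe_insert, Set.injOn_insert (mt Finset.mem_coe.1 hx), hφx]
    refine ⟨h.injOn.congr fun s hs => (hφS s hs).symm, ?_⟩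
    rintro ⟨s, hs, e⟩
    rw [hφS s hs] at e
    exact haS s hs e
  · intro s hs s' hs'
    rcases Finset.mem_insert.1 hs with h₁ | h₁ <;> rcases Finset.mem_insert.1 hs' with h₂ | h₂
    · simp [h₁, h₂]
    · rw [h₁, hφx, hφS _ h₂, G.adj_comm, hadj _ h₂, T.adj_comm]
    · rw [h₂, hφx, hφS _ h₁, hadj _ h₁]
    · rw [hφS _ h₁, hφS _ h₂, h.adj_iff _ h₁ _ h₂]
  · intro s hs s' hs' hss'
    rcases Finset.mem_insert.1 hs with h₁ | h₁ <;> rcases Finset.mem_insert.1 hs' with h₂ | h₂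
    · exact absurd (h₁.trans h₂.symm) hss'.ne
    · rw [h₁] at hss' ⊢
      rw [hφx, hφS _ h₂, (honly _ h₂).1 hss'.symm]
      exact Or.inr (hnbR _ htP _ haR)
    · rw [h₂] at hss' ⊢
      rw [hφx, hφS _ h₁, (honly _ h₁).1 hss']
      exact Or.inl (hnbR _ htP _ haR)
    · rw [hφS _ h₁, hφS _ h₂]
      exact h.edge _ h₁ _ h₂ hss'
  · intro s hs
    rcases Finset.mem_insert.1 hs with rfl | hs
    · rw [hφx]
      exact Or.inr ⟨t, Finset.mem_insert_of_mem ht, by rw [hφS t ht]; exact ⟨htP, haR⟩⟩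
    · rw [hφS s hs]
      refine (hparent s hs).imp id fun ⟨s', hs', hR⟩ =>
        ⟨s', Finset.mem_insert_of_mem hs', by rwa [hφS s' hs']⟩

theorem exists_embedding {W : Type*} [Fintype W] {T : SimpleGraph W} [T.LocallyFinite]
    (hT : T.IsTree) {N Δ : ℕ} (hG : PairSparse G N) (hΔ : 1 ≤ Δ)
    (hTΔ : ∀ w, T.degree w ≤ Δ) (hN : 4000 * Δ * Fintype.card W ≤ N) {nb : V → Finset V}
    (hnb : ∀ v, ∀ u ∈ nb v, G.Adj v u) (hdeg : ∀ v, 2000 * Δ ≤ #(nb v)) (r : V) :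
    ∃ φ : T ↪g G, ∀ a b, T.Adj a b → φ b ∈ nb (φ a) ∨ φ a ∈ nb (φ b) := by
  have key : ∀ m, m + 1 ≤ Fintype.card W → ∃ S φ P D L R, #S = m + 1 ∧
      IsPartialEmbedding G nb T (Fintype.card W) Δ r S φ P D L R := by
    intro m
    induction m with
    | zero =>
      intro hm
      obtain ⟨w⟩ := hT.connected.nonempty
      refine ⟨{w}, fun _ => r, ∅, ∅, fun _ => ∅, fun _ => ∅, by simp,
        isReservation_empty hG hm hΔ hN hnb r _ _, by simp, ?_, by simp, by simp, ?_,
        fun _ _ => Or.inl rfl⟩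
      · have : Unique ((({w} : Finset W) : Set W)) := by
          rw [Finset.coe_singleton]; infer_instance
        exact { preconnected := SimpleGraph.Preconnected.of_subsingleton }
      · intro s hs t ht hst
        rw [Finset.mem_singleton.1 hs, Finset.mem_singleton.1 ht] at hst
        exact absurd hst T.irrefl
    | succ m ih =>
      intro hm
      obtain ⟨S, φ, P, D, L, R, hS, h⟩ := ih (by omega)
      obtain ⟨S', φ', P', D', L', R', hS', h'⟩ :=
        h.extend hT hG hΔ hTΔ hN hnb hdeg (by omega)
      exact ⟨S', φ', P', D', L', R', by omega, h'⟩
  have hcard : 0 < Fintype.card W := Fintype.card_pos_iff.2 hT.connected.nonempty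
  obtain ⟨S, φ, P, D, L, R, hS, h⟩ := key (Fintype.card W - 1) (by omega)
  have hmem : ∀ w, w ∈ S := by
    rw [← Finset.eq_univ_iff_forall, ← Finset.card_eq_iff_eq_univ]
    omega
  exact ⟨⟨⟨φ, fun s t e => h.injOn (hmem s) (hmem t) e⟩, fun {s t} =>
    h.adj_iff s (hmem s) t (hmem t)⟩, fun s t hst => h.edge s (hmem s) t (hmem t) hst⟩

end InducedTree

theorem theorem1p3 {V W : Type*} [Nonempty V] [Fintype W] (G : SimpleGraph V) [G.LocallyFinite]
    (Δ n : ℕ)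
    (hmax : ∀ v : V, (G.degree v : ℝ) ≤ Real.exp ((Δ : ℝ) / 10 ^ 9))
    (hsparse : G.SmallSubgraphsSparse ((10 ^ 7 * Δ + 1) * n) (12 / 5))
    (T : SimpleGraph W) [T.LocallyFinite] (hT : T.IsTree) (hTn : Fintype.card W = n)
    (hTΔ : ∀ w : W, T.degree w ≤ Δ) :
    ((∀ v : V, 10 ^ 7 * Δ ≤ G.degree v) → T.IsIndContained G) ∧
    (∀ (J : SimpleGraph V) [J.LocallyFinite], J ≤ G → (∀ v : V, 10 ^ 7 * Δ ≤ J.degree v) →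
      J.ContainsInducedIn G T) := by
  have main : ∀ (J : SimpleGraph V) [J.LocallyFinite], J ≤ G →
      (∀ v : V, 10 ^ 7 * Δ ≤ J.degree v) → J.ContainsInducedIn G T := by
    intro J _ hJG hJ
    obtain ⟨r⟩ := ‹Nonempty V›
    rcases subsingleton_or_nontrivial W with hW | hW
    · have hno : ∀ a b, ¬ T.Adj a b := fun a b hab => hab.ne (Subsingleton.elim a b)
      refine ⟨⟨⟨fun _ => r, fun a b _ => Subsingleton.elim a b⟩, fun {a b} => ?_⟩,
        fun a b hab => absurd hab (hno a b)⟩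
      exact iff_of_false G.irrefl (hno a b)
    · obtain ⟨w⟩ := hT.connected.nonempty
      -- A tree with two vertices has an edge, so `Δ = 0` does not occur here.
      have hΔ : 1 ≤ Δ :=
        (hT.connected.preconnected.degree_pos_of_nontrivial w).trans_le (hTΔ w)
      have hN : 4000 * Δ * Fintype.card W ≤ (10 ^ 7 * Δ + 1) * n := by
        rw [hTn]
        exact Nat.mul_le_mul_right _ (by omega)
      obtain ⟨φ, hφ⟩ := InducedTree.exists_embedding hT
        (InducedTree.pairSparse_of_smallSubgraphsSparse hsparse) hΔ hTΔ hN
        (nb := fun v => J.neighborFinset v)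
        (fun v u hu => hJG ((SimpleGraph.mem_neighborFinset _ _ _).1 hu))
        (fun v => by
          have := hJ v
          rw [SimpleGraph.card_neighborFinset_eq_degree]
          omega) r
      refine ⟨φ, fun a b hab => ?_⟩
      rcases hφ a b hab with h | h
      · exact (SimpleGraph.mem_neighborFinset _ _ _).1 h
      · exact ((SimpleGraph.mem_neighborFinset _ _ _).1 h).symm
  exact ⟨fun hG => ⟨(main G le_rfl hG).choose⟩, main⟩
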